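/- **Lemma 1.6.** Let $R$ and $S$ be polynomial rings in finitely many variables over a field $K$, with no common variables, and put $T=R\otimes_K S$. Let $I\subseteq R$ and $J\subseteq S$ be squarefree monomial ideals, that is, ideals generated by squarefree monomials, and let $IT+JT$ be the ideal of $T$ generated by the images of $I$ and $J$. (1) $\operatorname{pd}_T T/(IT+JT)=\operatorname{pd}_R R/I+\operatorname{pd}_S S/J$. (The projective dimension of the zero module is $-\infty$.) (2) For a finite subset $\mathcal P$ of a commutative ring $A$ and subsets $\mathcal P_0,\dots,\mathcal P_r$ of $\mathcal P$ $(r\ge 0)$, consider the following conditions: - (SV1) $\mathcal P=\mathcal P_0\cup\mathcal P_1\cup\dots\cup\mathcal P_r$; - (SV2) $\sharp\mathcal P_0=1$; - (SV3) for each $\ell$ with $0<\ell\le r$ and all $a,a''\in\mathcal P_\ell$ with $a\ne a''$, there exist an integer $\ell'$ with $0\le\ell'<\ell$, an element $a'\in\mathcal P_{\ell'}$ and an element $b$ of the ideal $(\mathcal P)$ generated by $\mathcal P$ such that $aa''=a'b$. Let $\mathcal P\subseteq R$ be a finite generating set of $I$ and $\mathcal Q\subseteq S$ a finite generating set of $J$.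 If $\mathcal P$ with $\mathcal P_0,\dots,\mathcal P_r$, and $\mathcal Q$ with $\mathcal Q_0,\dots,\mathcal Q_s$, satisfy (SV1), (SV2) and (SV3), then the images of $\mathcal P$ and $\mathcal Q$ in $T$ together generate $IT+JT$, and their union, with the sequence of (the images in $T$ of) $\mathcal P_0,\dots,\mathcal P_r,\mathcal Q_0,\dots,\mathcal Q_s$ in this order, also satisfies (SV1), (SV2) and (SV3). -/

import Mathlib

open scoped TensorProduct

/-- An ideal of the polynomial ring `K[x_i : i ∈ σ]` is a squarefree monomial ideal if it is
generated by a set of squarefree monomials `∏_{i ∈ F} x_i`, where `F` is a finite set of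
variables. -/
def IsSquarefreeMonomialIdeal {K σ : Type*} [Field K] (I : Ideal (MvPolynomial σ K)) : Prop :=
  ∃ A : Set (Finset σ),
    I = Ideal.span ((fun F : Finset σ => ∏ i ∈ F, (MvPolynomial.X i : MvPolynomial σ K)) '' A)

/-- The projective dimension `pd_A A/I`, with value `⊥` (that is, `-∞`) if `A/I = 0`. -/
noncomputable def pdQuotient {A : Type*} [CommRing A] (I : Ideal A) : WithBot ℕ∞ :=
  CategoryTheory.projectiveDimension (ModuleCat.of A (A ⧸ I))

/-- The Schmitt–Vogel conditions (in their form for reductions) for a finite subset `P` of a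
commutative ring and subsets `D 0, …, D r` of `P`: the `D l` cover `P`, `D 0` has one element, and
the product of two distinct elements of `D l`, `l > 0`, is `a' * b` with `a'` in an earlier `D l'`
and `b` in the ideal generated by `P`. -/
structure SatisfiesSV {A : Type*} [CommRing A] (P : Set A) {r : ℕ}
    (D : Fin (r + 1) → Set A) : Prop where
  finite : P.Finite
  sv1 : P = ⋃ l, D l
  sv2 : (D 0).ncard = 1
  sv3 : ∀ l : Fin (r + 1), 0 < l → ∀ a ∈ D l, ∀ a'' ∈ D l, a ≠ a'' →
    ∃ l' : Fin (r + 1), l' < l ∧ ∃ a' ∈ D l', ∃ b ∈ Ideal.span P, a * a'' = a' * b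

/-- The inclusion `R → T = R ⊗_K S` for `R = K[x_i : i ∈ σ]` and `S = K[y_j : j ∈ τ]`. -/
noncomputable abbrev inclR (K σ τ : Type*) [Field K] :
    MvPolynomial σ K →ₐ[K] MvPolynomial σ K ⊗[K] MvPolynomial τ K :=
  Algebra.TensorProduct.includeLeft

/-- The inclusion `S → T = R ⊗_K S` for `R = K[x_i : i ∈ σ]` and `S = K[y_j : j ∈ τ]`. -/
noncomputable abbrev inclS (K σ τ : Type*) [Field K] :
    MvPolynomial τ K →ₐ[K] MvPolynomial σ K ⊗[K] MvPolynomial τ K :=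
  Algebra.TensorProduct.includeRight

/-! For (1), write `M ⊠ N` for `(T ⊗_R M) ⊗_T (T ⊗_S N)`. Then `T/(IT+JT)` is `R/I ⊠ S/J`, so it
suffices that `pd (M ⊠ N) = pd M + pd N` for finite modules over Noetherian `K`-algebras
(`projectiveDimension_eq_add`). No grading or minimal resolution is used.

Since `K` is a field, `T ⊗_S N ≅ R ⊗_K N` is free over `R`, so `⊠` is exact in each variable. It
also preserves projectives, and induction along syzygies gives `≤` (`hasPdLT_add`). If `N ≠ 0`, then
`M` is an `R`-direct summand of `M ⊠ N`, so `pd M ≤ pd (M ⊠ N)` (`hasPdLT_of_left`); this settles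
`≥` when a summand is zero or infinite.

Otherwise, passing to syzygies in each variable reduces `≥` to one claim: if neither `M` nor `N` is
projective, then `pd (M ⊠ N) ≥ 2` (`not_hasPdLT_two`). Take presentations `0 → A → B → M → 0` and `0
→ C → D → N → 0` with `B`, `D` finite free. If `pd (M ⊠ N) ≤ 1`, then `A ⊠ C → (B ⊠ C) × (A ⊠ D)`
splits. But some `Tor_1(R/I, M)` and `Tor_1(S/J, N)` are nonzero, and their external product lies in
the kernel of this map tensored with `R/I ⊠ S/J`, a contradiction.

For (2), relations within each family persist in `T`; the only new demand concerns `𝒬_0`, which is a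
singleton. -/

open CategoryTheory

universe w u v

/-! ### Bounds on projective dimension and syzygy shifts -/

/-- The `R`-module `M` has projective dimension `< n`. -/
def HasPdLT (R : Type u) [CommRing R] (M : Type w) [AddCommGroup M] [Module R M] (n : ℕ) : Prop :=
  HasProjectiveDimensionLT (ModuleCat.of R M) n

namespace HasPdLT

variable {R : Type u} [CommRing R] {A B M : Type w}
  [AddCommGroup A] [Module R A] [AddCommGroup B] [Module R B] [AddCommGroup M] [Module R M]

lemma mono {m n : ℕ} (hmn : m ≤ n) (h : HasPdLT R M m) : HasPdLT R M n :=
  have : HasProjectiveDimensionLT (ModuleCat.of R M) m := h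
  hasProjectiveDimensionLT_of_ge _ m n hmn

lemma zero_iff : HasPdLT R M 0 ↔ Subsingleton M := by
  rw [HasPdLT, hasProjectiveDimensionLT_zero_iff_isZero, ModuleCat.isZero_iff_subsingleton]

lemma one_iff [Small.{w} R] : HasPdLT R M 1 ↔ Module.Projective R M := by
  rw [HasPdLT, ← projective_iff_hasProjectiveDimensionLT_one, IsProjective.iff_projective]

lemma of_retract (i : A →ₗ[R] B) (r : B →ₗ[R] A) (h : r ∘ₗ i = LinearMap.id) {n : ℕ}
    (hB : HasPdLT R B n) : HasPdLT R A n :=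
  have : HasProjectiveDimensionLT (ModuleCat.of R B) n := hB
  Retract.hasProjectiveDimensionLT (Y := ModuleCat.of R B)
    { i := ModuleCat.ofHom i, r := ModuleCat.ofHom r
      retract := by rw [← ModuleCat.ofHom_comp, h]; rfl } n

section Exact

variable {f : A →ₗ[R] B} {g : B →ₗ[R] M} (hf : Function.Injective f) (hfg : Function.Exact f g)
  (hg : Function.Surjective g)

include hf hfg hg

lemma shortExact : (ModuleCat.shortComplexOfCompEqZero f g hfg.linearMap_comp_eq_zero).ShortExact :=
  ModuleCat.shortComplex_shortExact _ hfg hf hg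

lemma left {n : ℕ} (hB : HasPdLT R B n) (hM : HasPdLT R M (n + 1)) : HasPdLT R A n :=
  (shortExact hf hfg hg).hasProjectiveDimensionLT_X₁ n hB hM

lemma right {n : ℕ} (hA : HasPdLT R A n) (hB : HasPdLT R B (n + 1)) : HasPdLT R M (n + 1) :=
  (shortExact hf hfg hg).hasProjectiveDimensionLT_X₃ n hA hB

end Exact

/-- The shift starts at `n + 2` because the kernel of a surjection between projective modules is
projective but need not vanish. -/
lemma ker_of_projective [Small.{w} R] [Module.Projective R B] {g : B →ₗ[R] M}
    (hg : Function.Surjective g) {n : ℕ} (h : HasPdLT R M (n + 2)) :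
    HasPdLT R (LinearMap.ker g) (n + 1) :=
  left (LinearMap.ker g).injective_subtype (LinearMap.exact_subtype_ker_map g) hg
    ((one_iff.mpr ‹_›).mono (by omega)) h

lemma of_ker_of_projective [Small.{w} R] [Module.Projective R B] {g : B →ₗ[R] M}
    (hg : Function.Surjective g) {n : ℕ} (h : HasPdLT R (LinearMap.ker g) (n + 1)) :
    HasPdLT R M (n + 2) :=
  right (LinearMap.ker g).injective_subtype (LinearMap.exact_subtype_ker_map g) hg h
    ((one_iff.mpr ‹_›).mono (by omega))

end HasPdLT

/-! ### Covers by free and projective modules, restriction of scalars -/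

lemma exists_finite_free_surjective (R : Type u) [CommRing R] [Small.{w} R] (M : Type w)
    [AddCommGroup M] [Module R M] [Module.Finite R M] :
    ∃ (F : Type w) (_ : AddCommGroup F) (_ : Module R F) (p : F →ₗ[R] M),
      Module.Free R F ∧ Module.Finite R F ∧ Function.Surjective p := by
  obtain ⟨n, f, hf⟩ := Module.Finite.exists_fin' R M
  let e : (Fin n → Shrink.{w} R) ≃ₗ[R] (Fin n → R) :=
    LinearEquiv.piCongrRight fun _ => Shrink.linearEquiv R R
  exact ⟨Fin n → Shrink.{w} R, inferInstance, inferInstance, f ∘ₗ e.toLinearMap,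
    Module.Free.of_equiv e.symm, Module.Finite.equiv e.symm, hf.comp e.surjective⟩

lemma exists_projective_surjective (R : Type u) [CommRing R] [Small.{w} R] (M : Type w)
    [AddCommGroup M] [Module R M] :
    ∃ (F : Type w) (_ : AddCommGroup F) (_ : Module R F) (p : F →ₗ[R] M),
      Module.Projective R F ∧ Function.Surjective p := by
  let e : (M →₀ Shrink.{w} R) ≃ₗ[R] (M →₀ R) :=
    Finsupp.mapRange.linearEquiv (Shrink.linearEquiv R R)
  exact ⟨M →₀ Shrink.{w} R, inferInstance, inferInstance,
    Finsupp.linearCombination R id ∘ₗ e.toLinearMap, Module.Projective.of_equiv e.symm,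
    (Finsupp.linearCombination_id_surjective R M).comp e.surjective⟩

lemma projective_restrictScalars (R : Type u) [CommRing R] (T : Type w) [CommRing T] [Algebra R T]
    [Module.Projective R T] (F : Type v) [AddCommGroup F] [Module R F] [Module T F]
    [IsScalarTower R T F] [Module.Projective T F] : Module.Projective R F := by
  obtain ⟨s, hs⟩ := ‹Module.Projective T F›
  have : Module.Projective R (F →₀ T) := by
    classical
    exact Module.Projective.of_equiv (finsuppLequivDFinsupp (ι := F) (M := T) R).symm
  refine Module.Projective.of_split (s.restrictScalars R)
    ((Finsupp.linearCombination T id).restrictScalars R) ?_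
  ext x
  exact hs x

/-- Projective `T`-modules are projective over `R`, so syzygies over `T` also serve as syzygies over
`R`. -/
lemma HasPdLT.restrictScalars (R : Type u) [CommRing R] [Small.{w} R] (T : Type v) [CommRing T]
    [Small.{w} T] [Algebra R T] [Module.Projective R T] {n : ℕ} (Y : Type w) [AddCommGroup Y]
    [Module R Y] [Module T Y] [IsScalarTower R T Y] (h : HasPdLT T Y n) : HasPdLT R Y n := by
  match n with
  | 0 => exact zero_iff.mpr (zero_iff.mp h)
  | n + 1 =>
    induction n generalizing Y with
    | zero =>
      have := one_iff.mp h
      exact one_iff.mpr (projective_restrictScalars R T Y)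
    | succ n ih =>
      obtain ⟨F, _, _, p, _, hp⟩ := exists_projective_surjective T Y
      let := Module.compHom F (algebraMap R T)
      have : IsScalarTower R T F := IsScalarTower.of_algebraMap_smul fun _ _ => rfl
      have := projective_restrictScalars R T F
      exact of_ker_of_projective (g := p.restrictScalars R) hp
        (ih (LinearMap.ker p) (ker_of_projective hp h))

/-! ### The external tensor product and its right exactness -/

/-- The external tensor product over `T` of an `R`-module and an `S`-module. -/
def ExtTensor (R S T M N : Type*) [CommRing R] [CommRing S] [CommRing T] [Algebra R T]
    [Algebra S T] [AddCommGroup M] [Module R M] [AddCommGroup N] [Module S N] : Type _ :=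
  (T ⊗[R] M) ⊗[T] (T ⊗[S] N)

namespace ExtTensor

section Instances

variable (R S T M N : Type*) [CommRing R] [CommRing S] [CommRing T] [Algebra R T]
    [Algebra S T] [AddCommGroup M] [Module R M] [AddCommGroup N] [Module S N]

noncomputable instance : AddCommGroup (ExtTensor R S T M N) :=
  TensorProduct.addCommGroup (R := T) (M := T ⊗[R] M) (N := T ⊗[S] N)

noncomputable instance : Module T (ExtTensor R S T M N) :=
  TensorProduct.instModule (R := T) (M := T ⊗[R] M) (N := T ⊗[S] N)

/-- The external tensor product unfolded. -/
noncomputable def unfold : ExtTensor R S T M N ≃ₗ[T] (T ⊗[R] M) ⊗[T] (T ⊗[S] N) :=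
  LinearEquiv.refl T ((T ⊗[R] M) ⊗[T] (T ⊗[S] N))

instance [Module.Projective R M] [Module.Projective S N] :
    Module.Projective T (ExtTensor R S T M N) :=
  Module.Projective.of_equiv (unfold R S T M N).symm

variable {R S T M N}

/-- The pure tensor `(t ⊗ m) ⊗ (s ⊗ n)`. -/
noncomputable def pure (t : T) (m : M) (s : T) (n : N) : ExtTensor R S T M N :=
  (unfold R S T M N).symm ((t ⊗ₜ m) ⊗ₜ (s ⊗ₜ n))

lemma induction_on {motive : ExtTensor R S T M N → Prop} (x : ExtTensor R S T M N)
    (zero : motive 0) (add : ∀ x y, motive x → motive y → motive (x + y))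
    (tmul : ∀ t m s n, motive (pure t m s n)) : motive x := by
  suffices ∀ y, motive ((unfold R S T M N).symm y) from this (unfold R S T M N x)
  intro y
  induction y using TensorProduct.induction_on with
  | zero => exact zero
  | add x y hx hy => exact add _ _ hx hy
  | tmul a b =>
    induction a using TensorProduct.induction_on with
    | zero => rw [TensorProduct.zero_tmul]; exact zero
    | add x y hx hy => rw [TensorProduct.add_tmul]; exact add _ _ hx hy
    | tmul t m =>
      induction b using TensorProduct.induction_on with
      | zero => rw [TensorProduct.tmul_zero]; exact zero
      | add x y hx hy => rw [TensorProduct.tmul_add]; exact add _ _ hx hy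
      | tmul s n => exact tmul t m s n

lemma hom_ext {Y : Type*} [AddCommGroup Y] [Module T Y] {f g : ExtTensor R S T M N →ₗ[T] Y}
    (h : ∀ t m s n, f (pure t m s n) = g (pure t m s n)) : f = g := by
  refine LinearMap.ext fun x => ?_
  induction x using induction_on with
  | zero => rw [map_zero, map_zero]
  | add x y hx hy => rw [map_add, map_add, hx, hy]
  | tmul t m s n => exact h t m s n

lemma pure_add_left (t : T) (m m' : M) (s : T) (n : N) :
    (pure t (m + m') s n : ExtTensor R S T M N) = pure t m s n + pure t m' s n := by
  simp only [pure, TensorProduct.tmul_add, TensorProduct.add_tmul, map_add]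

lemma pure_zero_left (t : T) (s : T) (n : N) : (pure t 0 s n : ExtTensor R S T M N) = 0 := by
  simp only [pure, TensorProduct.tmul_zero, TensorProduct.zero_tmul, map_zero]

lemma pure_add_right (t : T) (m : M) (s : T) (n n' : N) :
    (pure t m s (n + n') : ExtTensor R S T M N) = pure t m s n + pure t m s n' := by
  simp only [pure, TensorProduct.tmul_add, map_add]

lemma pure_zero_right (t : T) (m : M) (s : T) : (pure t m s 0 : ExtTensor R S T M N) = 0 := by
  simp only [pure, TensorProduct.tmul_zero, map_zero]

end Instances

section Map

variable (R S T : Type*) [CommRing R] [CommRing S] [CommRing T] [Algebra R T] [Algebra S T]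
  {M M' M'' N N' N'' : Type*} [AddCommGroup M] [Module R M] [AddCommGroup M'] [Module R M']
  [AddCommGroup M''] [Module R M''] [AddCommGroup N] [Module S N] [AddCommGroup N'] [Module S N']
  [AddCommGroup N''] [Module S N'']

/-- Functoriality of the external tensor product. -/
noncomputable def map (f : M →ₗ[R] M') (g : N →ₗ[S] N') :
    ExtTensor R S T M N →ₗ[T] ExtTensor R S T M' N' :=
  TensorProduct.map (f.baseChange T) (g.baseChange T)

lemma map_comp (f' : M' →ₗ[R] M'') (f : M →ₗ[R] M') (g' : N' →ₗ[S] N'') (g : N →ₗ[S] N') :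
    map R S T (f' ∘ₗ f) (g' ∘ₗ g) = map R S T f' g' ∘ₗ map R S T f g :=
  hom_ext fun _ _ _ _ => rfl

lemma map_map (f' : M' →ₗ[R] M'') (f : M →ₗ[R] M') (g' : N' →ₗ[S] N'') (g : N →ₗ[S] N')
    (x : ExtTensor R S T M N) :
    map R S T f' g' (map R S T f g x) = map R S T (f' ∘ₗ f) (g' ∘ₗ g) x := by
  rw [map_comp]; rfl

lemma map_zero_left (g : N →ₗ[S] N') : map R S T (0 : M →ₗ[R] M') g = 0 :=
  hom_ext fun _ _ _ _ => pure_zero_left _ _ _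

lemma map_zero_right (f : M →ₗ[R] M') : map R S T f (0 : N →ₗ[S] N') = 0 :=
  hom_ext fun _ _ _ _ => pure_zero_right _ _ _

lemma map_add_left (f f' : M →ₗ[R] M') (g : N →ₗ[S] N') :
    map R S T (f + f') g = map R S T f g + map R S T f' g :=
  hom_ext fun _ _ _ _ => pure_add_left _ _ _ _ _

variable (M N) in
/-- Symmetry of the external tensor product. -/
noncomputable def comm : ExtTensor R S T M N ≃ₗ[T] ExtTensor S R T N M :=
  unfold R S T M N ≪≫ₗ TensorProduct.comm T _ _ ≪≫ₗ (unfold S R T N M).symm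

lemma comm_map (f : M →ₗ[R] M') (g : N →ₗ[S] N') (x : ExtTensor R S T M N) :
    comm R S T M' N' (map R S T f g x) = map S R T g f (comm R S T M N x) := by
  induction x using induction_on with
  | zero => rw [map_zero, map_zero, map_zero, map_zero]
  | add x y hx hy => rw [map_add, map_add, map_add, map_add, hx, hy]
  | tmul t m s n => rfl

lemma map_surjective {f : M →ₗ[R] M'} {g : N →ₗ[S] N'} (hf : Function.Surjective f)
    (hg : Function.Surjective g) : Function.Surjective (map R S T f g) := by
  have h1 : Function.Surjective (f.baseChange T) := LinearMap.lTensor_surjective T hf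
  have h2 : Function.Surjective (g.baseChange T) := LinearMap.lTensor_surjective T hg
  exact TensorProduct.map_surjective h1 h2

variable (N) in
lemma exact_map_left {f : M →ₗ[R] M'} {f' : M' →ₗ[R] M''} (h : Function.Exact f f')
    (hf' : Function.Surjective f') :
    Function.Exact (map R S T f (.id : N →ₗ[S] N)) (map R S T f' (.id : N →ₗ[S] N)) := by
  have h1 : Function.Exact (f.baseChange T) (f'.baseChange T) := lTensor_exact T h hf'
  have := rTensor_exact (T ⊗[S] N) h1 (LinearMap.lTensor_surjective T hf')
  rw [LinearMap.rTensor, LinearMap.rTensor, ← LinearMap.baseChange_id] at this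
  exact this

variable (M) in
lemma exact_map_right {g : N →ₗ[S] N'} {g' : N' →ₗ[S] N''} (h : Function.Exact g g')
    (hg' : Function.Surjective g') :
    Function.Exact (map R S T (.id : M →ₗ[R] M) g) (map R S T (.id : M →ₗ[R] M) g') := by
  have h1 : Function.Exact (g.baseChange T) (g'.baseChange T) := lTensor_exact T h hg'
  have := lTensor_exact (T ⊗[R] M) h1 (LinearMap.lTensor_surjective T hg')
  rw [LinearMap.lTensor, LinearMap.lTensor, ← LinearMap.baseChange_id] at this
  exact this

lemma ker_map {f : M →ₗ[R] M'} {f' : M' →ₗ[R] M''} (h : Function.Exact f f')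
    (hf' : Function.Surjective f') {g : N →ₗ[S] N'} {g' : N' →ₗ[S] N''} (hg : Function.Exact g g')
    (hg' : Function.Surjective g') :
    LinearMap.ker (map R S T f' g') =
      LinearMap.range (map R S T (.id : M' →ₗ[R] M') g) ⊔
        LinearMap.range (map R S T f (.id : N' →ₗ[S] N')) := by
  have h1 : Function.Exact (f.baseChange T) (f'.baseChange T) := lTensor_exact T h hf'
  have h2 : Function.Exact (g.baseChange T) (g'.baseChange T) := lTensor_exact T hg hg'
  have := TensorProduct.map_ker h1 (LinearMap.lTensor_surjective T hf') h2
    (LinearMap.lTensor_surjective T hg')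
  rw [LinearMap.lTensor, LinearMap.rTensor, ← LinearMap.baseChange_id,
    ← LinearMap.baseChange_id] at this
  exact this

end Map

/-! ### Exactness of the external tensor product over a field -/

section Field

variable (K R S T : Type*) [Field K] [CommRing R] [CommRing S] [CommRing T] [Algebra K R]
  [Algebra K S] [Algebra K T] [Algebra R T] [Algebra S T] [IsScalarTower K R T]
  [IsScalarTower K S T] [Algebra.IsPushout K R S T]

include K in
-- Cancelling the base change in `T = R ⊗_K S` gives `T ⊗_S N ≅ R ⊗_K N`, and `N` is free over the
-- field `K`.
lemma free_baseChange (N : Type*) [AddCommGroup N] [Module S N] :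
    Module.Free R (T ⊗[S] N) := by
  let := Module.compHom N (algebraMap K S)
  have : IsScalarTower K S N := IsScalarTower.of_algebraMap_smul fun _ _ => rfl
  exact Module.Free.of_equiv (Algebra.IsPushout.cancelBaseChange K R S T N).symm

include K in
lemma nontrivial_baseChange [Nontrivial R] (N : Type*) [AddCommGroup N] [Module S N]
    [Nontrivial N] : Nontrivial (T ⊗[S] N) := by
  let := Module.compHom N (algebraMap K S)
  have : IsScalarTower K S N := IsScalarTower.of_algebraMap_smul fun _ _ => rfl
  exact (Algebra.IsPushout.cancelBaseChange K R S T N).toEquiv.nontrivial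

include K S in
lemma projective_left : Module.Projective R T := by
  have : Module.Free R T := Module.Free.of_equiv
    (Algebra.IsPushout.equiv K R S T).toLinearEquiv
  infer_instance

/-- The external tensor product as a tensor product over `R`. -/
noncomputable def equivTensor (M N : Type*) [AddCommGroup M] [Module R M] [AddCommGroup N]
    [Module S N] : ExtTensor R S T M N ≃ₗ[T] (T ⊗[S] N) ⊗[R] M :=
  comm R S T M N ≪≫ₗ unfold S R T N M ≪≫ₗ
    TensorProduct.AlgebraTensorModule.cancelBaseChange R T T (T ⊗[S] N) M

variable {M M' N N' : Type*} [AddCommGroup M] [Module R M] [AddCommGroup M'] [Module R M']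
  [AddCommGroup N] [Module S N] [AddCommGroup N'] [Module S N']

lemma equivTensor_map (f : M →ₗ[R] M') (x : ExtTensor R S T M N) :
    equivTensor R S T M' N (map R S T f .id x) =
      LinearMap.lTensor (T ⊗[S] N) f (equivTensor R S T M N x) := by
  induction x using induction_on with
  | zero => simp only [map_zero]
  | add x y hx hy => simp only [map_add, hx, hy]
  | tmul t m s n => rfl

include K in
-- Up to isomorphism, `– ⊠ N` is tensoring over `R` with the free, hence flat, module `T ⊗_S N`.
lemma map_injective_left {f : M →ₗ[R] M'} (hf : Function.Injective f) :
    Function.Injective (map R S T f (.id : N →ₗ[S] N)) := by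
  have := free_baseChange K R S T N
  refine Function.Injective.of_comp (f := equivTensor R S T M' N) ?_
  have : equivTensor R S T M' N ∘ map R S T f .id =
      LinearMap.lTensor (T ⊗[S] N) f ∘ equivTensor R S T M N := funext (equivTensor_map R S T f)
  rw [this]
  exact (Module.Flat.lTensor_preserves_injective_linearMap f hf).comp
    (equivTensor R S T M N).injective

include K in
lemma map_injective_right {g : N →ₗ[S] N'} (hg : Function.Injective g) :
    Function.Injective (map R S T (.id : M →ₗ[R] M) g) := by
  have : Algebra.IsPushout K S R T := Algebra.IsPushout.symm inferInstance
  refine Function.Injective.of_comp (f := comm R S T M N') ?_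
  have : comm R S T M N' ∘ map R S T .id g = map S R T g .id ∘ comm R S T M N :=
    funext (comm_map R S T .id g)
  rw [this]
  exact (map_injective_left K S R T hg).comp (comm R S T M N).injective

include K in
lemma map_injective {f : M →ₗ[R] M'} (hf : Function.Injective f) {g : N →ₗ[S] N'}
    (hg : Function.Injective g) : Function.Injective (map R S T f g) := by
  rw [← LinearMap.comp_id f, ← LinearMap.id_comp g, map_comp]
  exact (map_injective_left K R S T hf).comp (map_injective_right K R S T hg)

include K in
lemma nontrivial [Nontrivial R] [Nontrivial M] [Nontrivial N] :
    Nontrivial (ExtTensor R S T M N) := by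
  have := free_baseChange K R S T N
  have := nontrivial_baseChange K R S T N
  exact (equivTensor R S T M N).toEquiv.nontrivial

end Field

/-! ### Upper bound, and comparison with one factor -/

section Dimension

variable (K R S : Type*) (T : Type w) [Field K] [CommRing R] [CommRing S] [CommRing T] [Algebra K R]
  [Algebra K S] [Algebra K T] [Algebra R T] [Algebra S T] [IsScalarTower K R T]
  [IsScalarTower K S T] [Algebra.IsPushout K R S T] [Small.{w} R] [Small.{w} S]

omit [Small.{w} S] in
include K in
-- Over `R`, `M ⊠ N` is `M` tensored with a nonzero free module, so it has `M` as a direct summand;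
-- restricting scalars from `T` to `R` does not raise projective dimension.
lemma hasPdLT_of_left {M N : Type w} [AddCommGroup M] [Module R M] [AddCommGroup N] [Module S N]
    [Nontrivial R] [Nontrivial N] {n : ℕ} (h : HasPdLT T (ExtTensor R S T M N) n) :
    HasPdLT R M n := by
  have := free_baseChange K R S T N
  have := nontrivial_baseChange K R S T N
  have := projective_left K R S T
  have h1 : HasPdLT T ((T ⊗[S] N) ⊗[R] M) n :=
    h.of_retract (equivTensor R S T M N).symm.toLinearMap (equivTensor R S T M N).toLinearMap
      (by ext; simp)
  have h2 := h1.restrictScalars R T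
  let b := Module.Free.chooseBasis R (T ⊗[S] N)
  obtain ⟨i⟩ := b.index_nonempty
  -- Inclusion along one basis vector, retracted by its coordinate function.
  refine h2.of_retract (TensorProduct.mk R (T ⊗[S] N) M (b i))
    ((TensorProduct.lid R M).toLinearMap ∘ₗ LinearMap.rTensor M (b.coord i)) ?_
  ext m
  simp

omit [Small.{w} R] in
include K in
lemma hasPdLT_of_projective {M N : Type w} [AddCommGroup M] [Module R M] [AddCommGroup N]
    [Module S N] [Module.Projective R M] {m : ℕ} (hN : HasPdLT S N (m + 1)) :
    HasPdLT T (ExtTensor R S T M N) (m + 1) := by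
  induction m generalizing N with
  | zero =>
    have := HasPdLT.one_iff.mp hN
    exact HasPdLT.one_iff.mpr inferInstance
  | succ m ih =>
    obtain ⟨F, _, _, p, _, hp⟩ := exists_projective_surjective S N
    have hF : HasPdLT T (ExtTensor R S T M F) 1 := HasPdLT.one_iff.mpr inferInstance
    exact HasPdLT.right
      (map_injective_right K R S T (M := M) (LinearMap.ker p).injective_subtype)
      (exact_map_right R S T M (LinearMap.exact_subtype_ker_map p) hp)
      (map_surjective R S T Function.surjective_id hp)
      (ih (HasPdLT.ker_of_projective hp hN)) (hF.mono (by omega))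

include K in
lemma hasPdLT_add {M N : Type w} [AddCommGroup M] [Module R M] [AddCommGroup N] [Module S N]
    {n m : ℕ} (hM : HasPdLT R M (n + 1)) (hN : HasPdLT S N (m + 1)) :
    HasPdLT T (ExtTensor R S T M N) (n + m + 1) := by
  induction n generalizing M with
  | zero =>
    have := HasPdLT.one_iff.mp hM
    exact (hasPdLT_of_projective K R S T hN).mono (by omega)
  | succ n ih =>
    obtain ⟨F, _, _, p, _, hp⟩ := exists_projective_surjective R M
    have hF := hasPdLT_of_projective K R S T (M := F) hN
    rw [show n + 1 + m + 1 = (n + m + 1) + 1 by omega]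
    exact HasPdLT.right
      (map_injective_left K R S T (N := N) (LinearMap.ker p).injective_subtype)
      (exact_map_left R S T N (LinearMap.exact_subtype_ker_map p) hp)
      (map_surjective R S T hp Function.surjective_id)
      (ih (HasPdLT.ker_of_projective hp hM)) (hF.mono (by omega))

end Dimension

end ExtTensor

/-! ### Flatness through `Tor_1` with cyclic modules -/

/-- The hypothesis `h` expresses `Tor_1(R/I, M) = 0`. The proof is the snake-lemma chase on the
sequences for `I`, `R`, `R/I` tensored with `A → B → M → 0`. -/
lemma flat_of_lTensor_quotient_injective {R A B M : Type*} [CommRing R] [AddCommGroup A]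
    [Module R A] [AddCommGroup B] [Module R B] [AddCommGroup M] [Module R M] [Module.Flat R B]
    {f : A →ₗ[R] B} {p : B →ₗ[R] M} (hfp : Function.Exact f p) (hp : Function.Surjective p)
    (h : ∀ I : Ideal R, Function.Injective (f.lTensor (R ⧸ I))) : Module.Flat R M := by
  rw [Module.Flat.iff_rTensor_injective']
  intro I
  rw [injective_iff_map_eq_zero]
  intro z hz
  obtain ⟨z', rfl⟩ := LinearMap.lTensor_surjective I hp z
  obtain ⟨a, ha⟩ := (lTensor_exact R hfp hp (I.subtype.rTensor B z')).mp (by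
    rw [← LinearMap.comp_apply, LinearMap.lTensor_comp_rTensor, ← LinearMap.rTensor_comp_lTensor]
    exact hz)
  -- The image of `a` in `(R/I) ⊗ B` vanishes because `a` maps to an element coming from `I ⊗ B`; by
  -- `h`, `a` itself comes from `I ⊗ A`.
  obtain ⟨z'', rfl⟩ := (rTensor_exact A (LinearMap.exact_subtype_mkQ I) I.mkQ_surjective a).mp (h I (by
    rw [map_zero, ← LinearMap.comp_apply, LinearMap.lTensor_comp_rTensor,
      ← LinearMap.rTensor_comp_lTensor, LinearMap.comp_apply, ha]
    exact (rTensor_exact B (LinearMap.exact_subtype_mkQ I) I.mkQ_surjective).apply_apply_eq_zero z'))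
  have : z' = f.lTensor I z'' := by
    apply Module.Flat.rTensor_preserves_injective_linearMap (M := B) I.subtype I.injective_subtype
    rw [← ha, ← LinearMap.comp_apply, LinearMap.lTensor_comp_rTensor,
      ← LinearMap.rTensor_comp_lTensor]
    rfl
  rw [this]
  exact (lTensor_exact I hfp hp).apply_apply_eq_zero z''

/-! ### Obstruction to splitting -/

namespace ExtTensor

section Interchange

variable (R S T : Type*) [CommRing R] [CommRing S] [CommRing T] [Algebra R T] [Algebra S T]
  (U V A C : Type*) [AddCommGroup U] [Module R U] [AddCommGroup V] [Module S V]
  [AddCommGroup A] [Module R A] [AddCommGroup C] [Module S C]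

/-- The external tensor product is compatible with tensor products. -/
noncomputable def interchange : ExtTensor R S T (U ⊗[R] A) (V ⊗[S] C) ≃ₗ[T]
    ExtTensor R S T U V ⊗[T] ExtTensor R S T A C :=
  unfold R S T _ _ ≪≫ₗ TensorProduct.congr
    (TensorProduct.AlgebraTensorModule.distribBaseChange R T U A)
    (TensorProduct.AlgebraTensorModule.distribBaseChange S T V C) ≪≫ₗ
  TensorProduct.tensorTensorTensorComm T _ _ _ _ ≪≫ₗ
  TensorProduct.congr (unfold R S T U V).symm (unfold R S T A C).symm

variable {A C} {B D : Type*} [AddCommGroup B] [Module R B] [AddCommGroup D] [Module S D]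

lemma interchange_map (f : A →ₗ[R] B) (g : C →ₗ[S] D)
    (x : ExtTensor R S T (U ⊗[R] A) (V ⊗[S] C)) :
    interchange R S T U V B D (map R S T (f.lTensor U) (g.lTensor V) x) =
      (map R S T f g).lTensor (ExtTensor R S T U V) (interchange R S T U V A C x) := by
  induction x using induction_on with
  | zero => simp only [map_zero]
  | add x y hx hy => simp only [map_add, hx, hy]
  | tmul t m s n =>
    induction m using TensorProduct.induction_on with
    | zero => simp only [pure_zero_left, map_zero]
    | add x y hx hy => simp only [pure_add_left, map_add, hx, hy]
    | tmul u a =>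
      induction n using TensorProduct.induction_on with
      | zero => simp only [pure_zero_right, map_zero]
      | add x y hx hy => simp only [pure_add_right, map_add, hx, hy]
      | tmul v c => rfl

end Interchange

section Split

variable (K R S T : Type*) [Field K] [CommRing R] [CommRing S] [CommRing T] [Algebra K R]
  [Algebra K S] [Algebra K T] [Algebra R T] [Algebra S T] [IsScalarTower K R T]
  [IsScalarTower K S T] [Algebra.IsPushout K R S T]
  {A B M : Type*} [AddCommGroup A] [Module R A] [AddCommGroup B] [Module R B]
  [AddCommGroup M] [Module R M] {C D N : Type*} [AddCommGroup C] [Module S C] [AddCommGroup D]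
  [Module S D] [AddCommGroup N] [Module S N]

include K in
/-- If `f` and `g` have a kernel after tensoring with `U` and `V`, then the map
`X(A, C) → X(B, C) × X(A, D)` is not a split monomorphism. -/
lemma retraction_ne_id (U V : Type*) [AddCommGroup U] [Module R U] [AddCommGroup V] [Module S V]
    {f : A →ₗ[R] B} {g : C →ₗ[S] D} (hf : ¬ Function.Injective (f.lTensor U))
    (hg : ¬ Function.Injective (g.lTensor V))
    (r₁ : ExtTensor R S T B C →ₗ[T] ExtTensor R S T A C)
    (r₂ : ExtTensor R S T A D →ₗ[T] ExtTensor R S T A C) :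
    r₁ ∘ₗ map R S T f .id + r₂ ∘ₗ map R S T .id g ≠ .id := by
  intro h
  have hf' : Nontrivial (LinearMap.ker (f.lTensor U)) := by
    rwa [Submodule.nontrivial_iff_ne_bot, ne_eq, LinearMap.ker_eq_bot]
  have hg' : Nontrivial (LinearMap.ker (g.lTensor V)) := by
    rwa [Submodule.nontrivial_iff_ne_bot, ne_eq, LinearMap.ker_eq_bot]
  have : Nontrivial R := (Module.nontrivial R (LinearMap.ker (f.lTensor U)))
  have := nontrivial K R S T (M := LinearMap.ker (f.lTensor U)) (N := LinearMap.ker (g.lTensor V))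
  obtain ⟨x, hx⟩ := exists_ne (0 : ExtTensor R S T (LinearMap.ker (f.lTensor U))
    (LinearMap.ker (g.lTensor V)))
  -- The product of the two kernels embeds in `(U ⊗ A) ⊠ (V ⊗ C)`, giving a nonzero `y` killed by
  -- `f` in the first variable and by `g` in the second.
  let y := map R S T (LinearMap.ker (f.lTensor U)).subtype (LinearMap.ker (g.lTensor V)).subtype x
  have hy : y ≠ 0 := by
    rw [ne_eq, map_eq_zero_iff _ (map_injective K R S T (Submodule.injective_subtype _)
      (Submodule.injective_subtype _))]
    exact hx
  have h1 : (map R S T f (.id : C →ₗ[S] C)).lTensor (ExtTensor R S T U V)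
      (interchange R S T U V A C y) = 0 := by
    rw [← interchange_map, map_map, show f.lTensor U ∘ₗ (LinearMap.ker (f.lTensor U)).subtype = 0
      from LinearMap.comp_ker_subtype _, map_zero_left, LinearMap.zero_apply, map_zero]
  have h2 : (map R S T (.id : A →ₗ[R] A) g).lTensor (ExtTensor R S T U V)
      (interchange R S T U V A C y) = 0 := by
    rw [← interchange_map, map_map, show g.lTensor V ∘ₗ (LinearMap.ker (g.lTensor V)).subtype = 0
      from LinearMap.comp_ker_subtype _, map_zero_right, LinearMap.zero_apply, map_zero]
  -- Tensoring the supposed identity with `U ⊠ V` and evaluating at `y` gives `0 = y`.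
  have h3 := LinearMap.congr_fun (congrArg (LinearMap.lTensor (ExtTensor R S T U V)) h)
    (interchange R S T U V A C y)
  rw [LinearMap.lTensor_add, LinearMap.lTensor_comp, LinearMap.lTensor_comp, LinearMap.add_apply,
    LinearMap.comp_apply, LinearMap.comp_apply, h1, h2, map_zero, map_zero, add_zero,
    LinearMap.lTensor_id, LinearMap.id_apply] at h3
  exact hy ((interchange R S T U V A C).map_eq_zero_iff.mp h3.symm)

include K in
-- This is exactness in the middle of the total complex of `A → B` and `C → D`. If `y` and `z` agree
-- in `B ⊠ D`, then `y` dies in `M ⊠ D`, hence already in `M ⊠ C`; so `y` comes from `A ⊠ C`, and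
-- injectivity of `f` on `A ⊠ D` determines `z`.
lemma exact_prod_coprod {f : A →ₗ[R] B} {p : B →ₗ[R] M} (hf : Function.Injective f)
    (hfp : Function.Exact f p) (hp : Function.Surjective p) {g : C →ₗ[S] D}
    (hg : Function.Injective g) :
    Function.Exact ((map R S T f (.id : C →ₗ[S] C)).prod (map R S T (.id : A →ₗ[R] A) g))
      ((map R S T (.id : B →ₗ[R] B) g).coprod (map R S T (-f) (.id : D →ₗ[S] D))) := by
  have hneg (x : ExtTensor R S T A D) :
      map R S T (-f) (.id : D →ₗ[S] D) x = - map R S T f (.id : D →ₗ[S] D) x := by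
    rw [eq_neg_iff_add_eq_zero, ← LinearMap.add_apply, ← map_add_left, neg_add_cancel,
      map_zero_left, LinearMap.zero_apply]
  rintro ⟨y, z⟩
  constructor
  · intro h
    rw [LinearMap.coprod_apply, hneg, add_neg_eq_zero] at h
    have h1 : map R S T p (.id : C →ₗ[S] C) y = 0 := by
      apply map_injective_right K R S T hg
      have := congrArg (map R S T p (.id : D →ₗ[S] D)) h
      rw [map_map, map_map, hfp.linearMap_comp_eq_zero, map_zero_left,
        LinearMap.zero_apply] at this
      rw [map_map, map_zero]
      exact this
    obtain ⟨x, rfl⟩ := (exact_map_left R S T C hfp hp y).mp h1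
    refine ⟨x, Prod.ext rfl ?_⟩
    apply map_injective_left K R S T hf
    rw [map_map] at h
    exact (map_map R S T _ _ _ _ x).trans h
  · rintro ⟨x, hx⟩
    obtain ⟨rfl, rfl⟩ := Prod.ext_iff.mp hx
    change map R S T _ _ (map R S T _ _ x) + map R S T (-f) _ (map R S T _ _ x) = 0
    rw [hneg, map_map, map_map]
    exact add_neg_cancel _

end Split

/-! ### The key lower bound -/

section Dimension

variable (K R S : Type*) (T : Type w) [Field K] [CommRing R] [CommRing S] [CommRing T] [Algebra K R]
  [Algebra K S] [Algebra K T] [Algebra R T] [Algebra S T] [IsScalarTower K R T]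
  [IsScalarTower K S T] [Algebra.IsPushout K R S T] [Small.{w} R] [Small.{w} S]
  [IsNoetherianRing R] [IsNoetherianRing S]

include K in
lemma not_hasPdLT_two {M N : Type w} [AddCommGroup M] [Module R M] [AddCommGroup N] [Module S N]
    [Module.Finite R M] [Module.Finite S N] (hM : ¬ HasPdLT R M 1)
    (hN : ¬ HasPdLT S N 1) :
    ¬ HasPdLT T (ExtTensor R S T M N) 2 := by
  intro h
  obtain ⟨B, _, _, p, _, _, hp⟩ := exists_finite_free_surjective R M
  obtain ⟨D, _, _, q, _, _, hq⟩ := exists_finite_free_surjective S N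
  have hfp := LinearMap.exact_subtype_ker_map p
  have hgq := LinearMap.exact_subtype_ker_map q
  have hf := (LinearMap.ker p).injective_subtype
  have hg := (LinearMap.ker q).injective_subtype
  set f := (LinearMap.ker p).subtype
  set g := (LinearMap.ker q).subtype
  -- Otherwise `M` would be flat and finitely presented, hence projective.
  obtain ⟨I, hI⟩ : ∃ I : Ideal R, ¬ Function.Injective (f.lTensor (R ⧸ I)) := by
    by_contra! hI
    have := flat_of_lTensor_quotient_injective hfp hp hI
    have := Module.finitePresentation_of_finite R M
    exact hM (HasPdLT.one_iff.mpr Module.Flat.projective_of_finitePresentation)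
  obtain ⟨J, hJ⟩ : ∃ J : Ideal S, ¬ Function.Injective (g.lTensor (S ⧸ J)) := by
    by_contra! hJ
    have := flat_of_lTensor_quotient_injective hgq hq hJ
    have := Module.finitePresentation_of_finite S N
    exact hN (HasPdLT.one_iff.mpr Module.Flat.projective_of_finitePresentation)
  -- Since `B ⊠ D` is projective, `pd (M ⊠ N) ≤ 1` makes the kernel of `B ⊠ D → M ⊠ N` projective.
  -- By right exactness this kernel is the range of `d`, so `d` splits onto its range.
  have hL := HasPdLT.one_iff.mp
    (HasPdLT.ker_of_projective (B := ExtTensor R S T B D) (g := map R S T p q)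
      (map_surjective R S T hp hq) h)
  set d := (map R S T (.id : B →ₗ[R] B) g).coprod (map R S T (-f) (.id : D →ₗ[S] D)) with hd
  have hex := exact_prod_coprod K R S T hf hfp hp hg
  rw [← hd] at hex
  have hfp' : Function.Exact (-f) p := fun x => by
    rw [hfp x]
    exact ⟨fun ⟨y, hy⟩ => ⟨-y, by simpa using hy⟩, fun ⟨y, hy⟩ => ⟨-y, by simpa using hy⟩⟩
  have hrange : LinearMap.range d = LinearMap.ker (map R S T p q) := by
    rw [ker_map R S T hfp' hp hgq hq, hd, LinearMap.range_coprod]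
  rw [← hrange] at hL
  obtain ⟨s, hs⟩ := LinearMap.exists_rightInverse_of_surjective d.rangeRestrict
    (LinearMap.range_rangeRestrict d)
  set e := (map R S T f (.id : LinearMap.ker q →ₗ[S] LinearMap.ker q)).prod
      (map R S T (.id : LinearMap.ker p →ₗ[R] LinearMap.ker p) g) with he
  have hinj : Function.Injective e := fun x y hxy =>
    map_injective_left K R S T hf (congrArg Prod.fst hxy)
  have hex' : Function.Exact e d.rangeRestrict := fun y => by
    rw [← hex y, Subtype.ext_iff]; rfl
  have hsplit : (Function.Injective e ∧ ∃ l, d.rangeRestrict ∘ₗ l = .id) ↔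
      (Function.Surjective d.rangeRestrict ∧ ∃ l, l ∘ₗ e = .id) := hex'.split_tfae'.out 0 1
  -- A section of `d` onto its range yields a retraction of `e`; its two components contradict
  -- `retraction_ne_id`.
  obtain ⟨-, r, hr⟩ := hsplit.mp ⟨hinj, s, hs⟩
  refine retraction_ne_id K R S T (R ⧸ I) (S ⧸ J) hI hJ (r ∘ₗ LinearMap.inl T _ _)
    (r ∘ₗ LinearMap.inr T _ _) ?_
  rw [← hr]
  refine LinearMap.ext fun x => ?_
  change r (_, 0) + r (0, _) = r (_, _)
  rw [← map_add, Prod.mk_add_mk, zero_add, add_zero]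
  rfl

end Dimension

end ExtTensor

/-! ### Translation to `projectiveDimension` -/

namespace HasPdLT

variable {R : Type u} [CommRing R] {M : Type w} [AddCommGroup M] [Module R M]

lemma iff_projectiveDimension_lt {n : ℕ} :
    HasPdLT R M n ↔ projectiveDimension (ModuleCat.of R M) < n :=
  projectiveDimension_lt_iff.symm

lemma projectiveDimension_eq_natCast_iff {n : ℕ} :
    projectiveDimension (ModuleCat.of R M) = n ↔ HasPdLT R M (n + 1) ∧ ¬ HasPdLT R M n := by
  rw [iff_projectiveDimension_lt, iff_projectiveDimension_lt, not_lt, Nat.cast_add, Nat.cast_one, ENat.WithBot.lt_add_one_iff,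
    le_antisymm_iff]

lemma projectiveDimension_eq_bot_iff_subsingleton :
    projectiveDimension (ModuleCat.of R M) = ⊥ ↔ Subsingleton M := by
  rw [projectiveDimension_eq_bot_iff, ModuleCat.isZero_iff_subsingleton]

lemma projectiveDimension_eq_top_iff :
    projectiveDimension (ModuleCat.of R M) = ⊤ ↔ ∀ n, ¬ HasPdLT R M n := by
  rw [← not_iff_not, ← ne_eq, projectiveDimension_ne_top_iff]
  push Not
  exact ⟨fun ⟨n, h⟩ => ⟨n + 1, h⟩, fun ⟨n, h⟩ => ⟨n, mono n.le_succ h⟩⟩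

end HasPdLT

/-! ### Additivity of projective dimension -/

namespace ExtTensor

section Dimension

variable (K R S : Type*) (T : Type w) [Field K] [CommRing R] [CommRing S] [CommRing T] [Algebra K R]
  [Algebra K S] [Algebra K T] [Algebra R T] [Algebra S T] [IsScalarTower K R T]
  [IsScalarTower K S T] [Algebra.IsPushout K R S T] [Small.{w} R] [Small.{w} S]
  [IsNoetherianRing R]

omit [Small.{w} R] [Small.{w} S] [IsNoetherianRing R] in
lemma hasPdLT_comm {M N : Type w} [AddCommGroup M] [Module R M] [AddCommGroup N] [Module S N]
    {n : ℕ} (h : HasPdLT T (ExtTensor R S T M N) n) : HasPdLT T (ExtTensor S R T N M) n :=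
  h.of_retract (comm R S T M N).symm.toLinearMap (comm R S T M N).toLinearMap (by ext; simp)

include K in
-- Reduction to `pd M = 1` with `N` fixed. As `F ⊠ N` has projective dimension at most `m`,
-- replacing `M` by a syzygy lowers both `pd M` and any bound on `pd (M ⊠ N)` by one.
lemma not_hasPdLT_of_one {N : Type w} [AddCommGroup N] [Module S N] {m : ℕ}
    (hN : HasPdLT S N (m + 1))
    (h1 : ∀ (M : Type w) [AddCommGroup M] [Module R M] [Module.Finite R M],
      HasPdLT R M 2 → ¬ HasPdLT R M 1 → ¬ HasPdLT T (ExtTensor R S T M N) (m + 1))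
    {M : Type w} [AddCommGroup M] [Module R M] [Module.Finite R M] {n : ℕ}
    (hM : HasPdLT R M (n + 2)) (hM' : ¬ HasPdLT R M (n + 1)) : ¬ HasPdLT T (ExtTensor R S T M N) (n + m + 1) := by
  induction n generalizing M with
  | zero =>
    rw [zero_add]
    exact h1 M hM hM'
  | succ n ih =>
    intro h
    obtain ⟨F, _, _, p, _, _, hp⟩ := exists_finite_free_surjective R M
    have hF := hasPdLT_of_projective K R S T (M := F) hN
    refine ih (M := LinearMap.ker p) (HasPdLT.ker_of_projective hp hM)
      (fun h' => hM' (HasPdLT.of_ker_of_projective hp h')) ?_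
    refine HasPdLT.left
      (map_injective_left K R S T (N := N) (LinearMap.ker p).injective_subtype)
      (exact_map_left R S T N (LinearMap.exact_subtype_ker_map p) hp)
      (map_surjective R S T hp Function.surjective_id) (hF.mono (by omega)) ?_
    rwa [show n + m + 1 + 1 = n + 1 + m + 1 by omega]

variable [IsNoetherianRing S]

include K in
lemma not_hasPdLT_add {M N : Type w} [AddCommGroup M] [Module R M] [AddCommGroup N] [Module S N]
    [Module.Finite R M] [Module.Finite S N] {n m : ℕ} (hM : HasPdLT R M (n + 2))
    (hN : HasPdLT S N (m + 2)) (hM' : ¬ HasPdLT R M (n + 1)) (hN' : ¬ HasPdLT S N (m + 1)) :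
    ¬ HasPdLT T (ExtTensor R S T M N) (n + 1 + m + 1) := by
  have : Algebra.IsPushout K S R T := Algebra.IsPushout.symm inferInstance
  rw [show n + 1 + m + 1 = n + (m + 1) + 1 by omega]
  -- The reduction is applied to `M`, then with the factors exchanged to `N`, leaving two modules of
  -- projective dimension one.
  refine not_hasPdLT_of_one K R S T hN (fun M' _ _ _ h2 h1 h => ?_) hM hM'
  refine not_hasPdLT_of_one K S R T h2 (fun N' _ _ _ _ h1' => ?_) hN hN' (hasPdLT_comm R S T h)
  exact not_hasPdLT_two K S R T h1' h1

include K in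
lemma not_hasPdLT_add_of_not {M N : Type w} [AddCommGroup M] [Module R M] [AddCommGroup N] [Module S N]
    [Module.Finite R M] [Module.Finite S N] [Nontrivial R] [Nontrivial S] [Nontrivial M]
    [Nontrivial N] {n m : ℕ} (hM : HasPdLT R M (n + 1)) (hN : HasPdLT S N (m + 1))
    (hM' : ¬ HasPdLT R M n) (hN' : ¬ HasPdLT S N m) :
    ¬ HasPdLT T (ExtTensor R S T M N) (n + m) := by
  have : Algebra.IsPushout K S R T := Algebra.IsPushout.symm inferInstance
  match n, m with
  | 0, m =>
    rw [zero_add]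
    exact fun h => hN' (hasPdLT_of_left K S R T (hasPdLT_comm R S T h))
  | n + 1, 0 => exact fun h => hM' (hasPdLT_of_left K R S T h)
  | n + 1, m + 1 => exact not_hasPdLT_add K R S T hM hN hM' hN'

include K in
/-- Projective dimension is additive for external tensor products of finite modules. -/
theorem projectiveDimension_eq_add {M N : Type w} [AddCommGroup M] [Module R M] [AddCommGroup N]
    [Module S N] [Module.Finite R M] [Module.Finite S N] :
    projectiveDimension (ModuleCat.of T (ExtTensor R S T M N)) =
      projectiveDimension (ModuleCat.of R M) + projectiveDimension (ModuleCat.of S N) := by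
  have : Algebra.IsPushout K S R T := Algebra.IsPushout.symm inferInstance
  have hbot : Subsingleton M ∨ Subsingleton N →
      projectiveDimension (ModuleCat.of T (ExtTensor R S T M N)) = ⊥ := by
    intro h
    rw [HasPdLT.projectiveDimension_eq_bot_iff_subsingleton, (unfold R S T M N).subsingleton_congr]
    rcases h with h | h <;> infer_instance
  -- Zero modules come before infinite dimensions, since `⊥ + ⊤ = ⊥`.
  rcases subsingleton_or_nontrivial M with hM | hM
  · rw [hbot (.inl hM), HasPdLT.projectiveDimension_eq_bot_iff_subsingleton.mpr hM,
      WithBot.bot_add]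
  rcases subsingleton_or_nontrivial N with hN | hN
  · rw [hbot (.inr hN), HasPdLT.projectiveDimension_eq_bot_iff_subsingleton.mpr hN,
      WithBot.add_bot]
  have := Module.nontrivial R M
  have := Module.nontrivial S N
  generalize ha : projectiveDimension (ModuleCat.of R M) = a
  generalize hb : projectiveDimension (ModuleCat.of S N) = b
  have ha' : a ≠ ⊥ := fun h => not_subsingleton M
    (HasPdLT.projectiveDimension_eq_bot_iff_subsingleton.mp (ha.trans h))
  have hb' : b ≠ ⊥ := fun h => not_subsingleton N
    (HasPdLT.projectiveDimension_eq_bot_iff_subsingleton.mp (hb.trans h))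
  lift a to ℕ∞ using ha'
  lift b to ℕ∞ using hb'
  by_cases ha' : a = ⊤
  · subst ha'
    rw [← WithBot.coe_add, top_add]
    exact HasPdLT.projectiveDimension_eq_top_iff.mpr fun n h =>
      HasPdLT.projectiveDimension_eq_top_iff.mp ha n (hasPdLT_of_left K R S T h)
  by_cases hb' : b = ⊤
  · subst hb'
    rw [← WithBot.coe_add, add_top]
    exact HasPdLT.projectiveDimension_eq_top_iff.mpr fun n h =>
      HasPdLT.projectiveDimension_eq_top_iff.mp hb n
        (hasPdLT_of_left K S R T (hasPdLT_comm R S T h))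
  lift a to ℕ using ha'
  lift b to ℕ using hb'
  obtain ⟨ha1, ha2⟩ := HasPdLT.projectiveDimension_eq_natCast_iff.mp ha
  obtain ⟨hb1, hb2⟩ := HasPdLT.projectiveDimension_eq_natCast_iff.mp hb
  exact HasPdLT.projectiveDimension_eq_natCast_iff.mpr ⟨hasPdLT_add K R S T ha1 hb1,
    not_hasPdLT_add_of_not K R S T ha1 hb1 ha2 hb2⟩

end Dimension

end ExtTensor

/-! ### Quotient rings -/

/-- `T/I ⊗ T/J ≅ T/(I + J)`. -/
noncomputable def quotientTensorQuotientEquivSup {T : Type*} [CommRing T] (I J : Ideal T) :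
    (T ⧸ I) ⊗[T] (T ⧸ J) ≃ₗ[T] T ⧸ (I ⊔ J) :=
  TensorProduct.tensorQuotEquivQuotSMul (T ⧸ I) J ≪≫ₗ
  Submodule.quotEquivOfEq _ _ (by
    rw [← LinearMap.range_eq_top.mpr I.mkQ_surjective, ← Submodule.map_top, ← Submodule.map_smul'',
      smul_eq_mul, Ideal.mul_top]) ≪≫ₗ
  Submodule.quotientQuotientEquivQuotientSup I J

lemma pdQuotient_map_sup_map (K : Type*) {R : Type u} {S : Type v} (T : Type w) [Field K]
    [CommRing R] [CommRing S] [CommRing T] [Algebra K R] [Algebra K S] [Algebra K T] [Algebra R T]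
    [Algebra S T] [IsScalarTower K R T] [IsScalarTower K S T] [Algebra.IsPushout K R S T]
    [Small.{w} R] [Small.{w} S] [IsNoetherianRing R] [IsNoetherianRing S]
    (I : Ideal R) (J : Ideal S) :
    pdQuotient (I.map (algebraMap R T) ⊔ J.map (algebraMap S T)) = pdQuotient I + pdQuotient J := by
  -- Additivity needs both modules in the universe of `T`; the quotients are moved there and back.
  let eI : Shrink.{w} (R ⧸ I) ≃ₗ[R] R ⧸ I := Shrink.linearEquiv R _
  let eJ : Shrink.{w} (S ⧸ J) ≃ₗ[S] S ⧸ J := Shrink.linearEquiv S _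
  have := Module.Finite.equiv eI.symm
  have := Module.Finite.equiv eJ.symm
  have h := ExtTensor.projectiveDimension_eq_add K R S T (M := Shrink.{w} (R ⧸ I))
    (N := Shrink.{w} (S ⧸ J))
  let e : ExtTensor R S T (Shrink.{w} (R ⧸ I)) (Shrink.{w} (S ⧸ J)) ≃ₗ[T]
      T ⧸ (I.map (algebraMap R T) ⊔ J.map (algebraMap S T)) :=
    ExtTensor.unfold R S T _ _ ≪≫ₗ TensorProduct.congr
      (eI.baseChange R T _ _ ≪≫ₗ
        (Algebra.TensorProduct.quotIdealMapEquivTensorQuot T I).symm.toLinearEquiv)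
      (eJ.baseChange S T _ _ ≪≫ₗ
        (Algebra.TensorProduct.quotIdealMapEquivTensorQuot T J).symm.toLinearEquiv) ≪≫ₗ
      quotientTensorQuotientEquivSup _ _
  rw [pdQuotient, pdQuotient, pdQuotient, ← projectiveDimension_eq_of_iso e.toModuleIso, h,
    ModuleCat.projectiveDimension_eq_of_linearEquiv (M := ModuleCat.of R (Shrink.{w} (R ⧸ I)))
      (N := ModuleCat.of R (R ⧸ I)) eI,
    ModuleCat.projectiveDimension_eq_of_linearEquiv (M := ModuleCat.of S (Shrink.{w} (S ⧸ J)))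
      (N := ModuleCat.of S (S ⧸ J)) eJ]

/-! ### Schmitt–Vogel systems -/

/-- Each relation `a * a'' = a' * b` is carried along by the ring homomorphism, and its `b` stays in
the larger ideal. Distinct images have distinct preimages, so injectivity is not needed. There are
`r + s + 2` sets, hence the last index `r + 1 + s`. -/
lemma SatisfiesSV.image_union_image {A B C : Type*} [CommRing A] [CommRing B] [CommRing C]
    (f : A →+* C) (g : B →+* C) {P : Set A} {r : ℕ} {D : Fin (r + 1) → Set A} {Q : Set B} {s : ℕ}
    {E : Fin (s + 1) → Set B} (hP : SatisfiesSV P D) (hQ : SatisfiesSV Q E) :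
    SatisfiesSV (r := r + 1 + s) (f '' P ∪ g '' Q)
      (Fin.append (m := r + 1) (n := s + 1) (fun l => f '' D l) (fun l => g '' E l)) where
  finite := (hP.finite.image f).union (hQ.finite.image g)
  sv1 := by
    ext x
    rw [Set.mem_iUnion, Set.mem_union]
    constructor
    · rintro (h | h)
      · rw [hP.sv1, Set.image_iUnion, Set.mem_iUnion] at h
        obtain ⟨l, hl⟩ := h
        exact ⟨Fin.castAdd (s + 1) l, by rwa [Fin.append_left]⟩
      · rw [hQ.sv1, Set.image_iUnion, Set.mem_iUnion] at h
        obtain ⟨l, hl⟩ := h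
        exact ⟨Fin.natAdd (r + 1) l, by rwa [Fin.append_right]⟩
    · rintro ⟨l, hl⟩
      induction l using Fin.addCases (m := r + 1) (n := s + 1) with
      | left l =>
        rw [Fin.append_left] at hl
        rw [hP.sv1, Set.image_iUnion, Set.mem_iUnion]
        exact .inl ⟨l, hl⟩
      | right l =>
        rw [Fin.append_right] at hl
        rw [hQ.sv1, Set.image_iUnion (s := E), Set.mem_iUnion (s := fun l => g '' E l)]
        exact .inr ⟨l, hl⟩
  sv2 := by
    have h0 : (0 : Fin (r + 1 + s + 1)) = Fin.castAdd (s + 1) (0 : Fin (r + 1)) := rfl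
    obtain ⟨a, ha⟩ := Set.ncard_eq_one.mp hP.sv2
    rw [h0, Fin.append_left, ha, Set.image_singleton, Set.ncard_singleton]
  sv3 l hl a ha a'' ha'' hne := by
    induction l using Fin.addCases (m := r + 1) (n := s + 1) with
    | left l =>
      rw [Fin.append_left] at ha ha''
      obtain ⟨a, ha, rfl⟩ := ha
      obtain ⟨a'', ha'', rfl⟩ := ha''
      obtain ⟨l', hl', a', ha', b, hb, h⟩ := hP.sv3 l hl a ha a'' ha'' (ne_of_apply_ne f hne)
      refine ⟨Fin.castAdd (s + 1) l', hl', f a', ?_, f b, ?_, by rw [← map_mul, h, map_mul]⟩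
      · rw [Fin.append_left]
        exact Set.mem_image_of_mem f ha'
      · refine Ideal.span_mono Set.subset_union_left ?_
        rw [← Ideal.map_span]
        exact Ideal.mem_map_of_mem f hb
    | right l =>
      rw [Fin.append_right] at ha ha''
      obtain ⟨a, ha, rfl⟩ := ha
      obtain ⟨a'', ha'', rfl⟩ := ha''
      have hne' := ne_of_apply_ne g hne
      -- `E 0` now sits at the positive index `r + 1`, where (SV3) is required; being a singleton,
      -- it has no two distinct elements.
      have hl0 : 0 < l := by
        refine Fin.pos_iff_ne_zero.mpr fun h0 => hne' ?_
        subst h0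
        exact (Set.ncard_le_one_iff (hQ.finite.subset (hQ.sv1 ▸ Set.subset_iUnion E 0))).mp
          hQ.sv2.le ha ha''
      obtain ⟨l', hl', a', ha', b, hb, h⟩ := hQ.sv3 l hl0 a ha a'' ha'' hne'
      refine ⟨Fin.natAdd (r + 1) l', (Fin.natAdd_lt_natAdd_iff (r + 1)).mpr hl', g a', ?_, g b, ?_,
        by rw [← map_mul, h, map_mul]⟩
      · rw [Fin.append_right]
        exact Set.mem_image_of_mem g ha'
      · refine Ideal.span_mono Set.subset_union_right ?_
        rw [← Ideal.map_span]
        exact Ideal.mem_map_of_mem g hb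

lemma pdQuotient_tensorProduct (K : Type*) {R : Type u} {S : Type v} [Field K]
    [CommRing R] [CommRing S] [Algebra K R] [Algebra K S] [IsNoetherianRing R] [IsNoetherianRing S]
    (I : Ideal R) (J : Ideal S) :
    pdQuotient (I.map (Algebra.TensorProduct.includeLeft : R →ₐ[K] R ⊗[K] S) +
      J.map (Algebra.TensorProduct.includeRight : S →ₐ[K] R ⊗[K] S)) =
        pdQuotient I + pdQuotient J := by
  -- With this `S`-algebra structure on `R ⊗[K] S`, `algebraMap` from `S` is `includeRight`.
  let := Algebra.TensorProduct.rightAlgebra (R := K) (A := R) (B := S)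
  exact pdQuotient_map_sup_map K (R ⊗[K] S) I J

theorem lemma1p6 {K σ τ : Type*} [Field K] [Finite σ] [Finite τ]
    (I : Ideal (MvPolynomial σ K)) (J : Ideal (MvPolynomial τ K))
    (hI : IsSquarefreeMonomialIdeal I) (hJ : IsSquarefreeMonomialIdeal J) :
    pdQuotient (I.map (inclR K σ τ) + J.map (inclS K σ τ)) = pdQuotient I + pdQuotient J ∧
    ∀ (r s : ℕ)
      (P : Set (MvPolynomial σ K)) (D : Fin (r + 1) → Set (MvPolynomial σ K))
      (Q : Set (MvPolynomial τ K)) (E : Fin (s + 1) → Set (MvPolynomial τ K)),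
      Ideal.span P = I → SatisfiesSV P D →
      Ideal.span Q = J → SatisfiesSV Q E →
        Ideal.span (inclR K σ τ '' P ∪ inclS K σ τ '' Q) =
          I.map (inclR K σ τ) + J.map (inclS K σ τ) ∧
        SatisfiesSV (r := r + 1 + s) (inclR K σ τ '' P ∪ inclS K σ τ '' Q)
          (Fin.append (m := r + 1) (n := s + 1)
            (fun l => inclR K σ τ '' D l) (fun l => inclS K σ τ '' E l)) := by
  refine ⟨pdQuotient_tensorProduct K I J, ?_⟩
  rintro r s P D Q E rfl hP rfl hQ
  refine ⟨?_, hP.image_union_image (inclR K σ τ).toRingHom (inclS K σ τ).toRingHom hQ⟩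
  rw [Ideal.span_union, Ideal.map_span, Ideal.map_span]
  rfl
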